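/- Let $L$ be a finite distributive lattice with at least two elements, regarded as an algebra in the signature $\{\wedge,\vee\}$ (bounds are not part of the signature). Consider all lattice homomorphisms $f\colon L^m\to L$ with $m\ge 1$. For $f\colon L^m\to L$ and $g\colon L^k\to L$ write $g\preceq f$ (and say that $g$ is a minor of $f$) if there is a map $\tau\colon\{1,\dots,m\}\to\{1,\dots,k\}$ such that $g(a_1,\dots,a_k)=f(a_{\tau(1)},\dots,a_{\tau(m)})$ for all $a_1,\dots,a_k\in L$. This is a preorder; let the minor homomorphism poset of $L$ be the associated partially ordered set, obtained by identifying $f$ and $g$ whenever $f\preceq g$ and $g\preceq f$. For $j\ge 0$ let $\Pi_j$ be the lattice of partitions of $\{1,\dots,j\}$, where $\pi_1\le\pi_2$ iff every block of $\pi_1$ is contained in a block of $\pi_2$ (so $\Pi_0$ has exactly one element), and let $\Pi_j^\partial$ be its order dual. Then $L$ is complemented if and only if, for some $n\ge 1$, the minor homomorphism poset of $L$ is isomorphic, as a partially ordered set, to the disjoint union, for $j=0,1,\dots,n$, of $d_j:=\binom{n}{j}\,n^j\,2^{n-j}$ copies of $\Pi_j^\partial$ (elements of different copies being incomparable). -/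

import Mathlib

/-- A lattice homomorphism of several arguments from `A` to `B`: a positive arity `n` together with
a homomorphism `A ^ n → B` of (unbounded) lattices. -/
structure MultiLatticeHom (A B : Type*) [Lattice A] [Lattice B] where
  arity : ℕ
  arity_pos : 0 < arity
  toHom : LatticeHom (Fin arity → A) B

namespace MultiLatticeHom

variable {A B : Type*} [Lattice A] [Lattice B]

/-- `g` is a minor of `f` if `g (a₁, …, aₘ) = f (a_{τ 1}, …, a_{τ n})` for some map
`τ : [n] → [m]`, where `n` is the arity of `f` and `m` is the arity of `g`. -/
def IsMinor (g f : MultiLatticeHom A B) : Prop :=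
  ∃ τ : Fin f.arity → Fin g.arity, ∀ a : Fin g.arity → A, g.toHom a = f.toHom (fun i => a (τ i))

/-- The minor preorder: `g ≤ f` means that `g` is a minor of `f`. -/
instance instPreorder : Preorder (MultiLatticeHom A B) where
  le := IsMinor
  le_refl _ := ⟨id, fun _ => rfl⟩
  le_trans _ _ _ := fun ⟨σ, hσ⟩ ⟨τ, hτ⟩ =>
    ⟨fun i => σ (τ i), fun a => (hσ a).trans (hτ fun i => a (σ i))⟩

end MultiLatticeHom

/-- The minor homomorphism poset of a lattice `L`: the homomorphisms `L ^ n → L`, `n ≥ 1`, modulo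
minor equivalence (`f ≤ g` and `g ≤ f`), with the partial order induced by the minor preorder. -/
abbrev MinorHomPoset (L : Type*) [Lattice L] : Type _ :=
  Antisymmetrization (MultiLatticeHom L L) (· ≤ ·)

/-- The lattice of partitions of a `j`-element set, where `π₁ ≤ π₂` means that every block of `π₁`
is contained in a block of `π₂`. -/
abbrev PartitionLattice (j : ℕ) : Type :=
  Finpartition (Finset.univ : Finset (Fin j))

/-- The disjoint union, for `j = 0, …, n`, of `(n choose j) * n ^ j * 2 ^ (n - j)` copies of the
order dual of the `j`-th partition lattice. Elements of different copies are incomparable. -/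
abbrev DualPartitionUnion (n : ℕ) : Type :=
  Σ p : (Σ j : Fin (n + 1), Fin (n.choose j * n ^ (j : ℕ) * 2 ^ (n - (j : ℕ)))),
    (PartitionLattice (p.1 : ℕ))ᵒᵈ

/-! Let J be the set of sup-irreducibles of L; they are prime. For f : L^m → L and p ∈ J, the
predicate p ≤ f(a) respects ⊔ and ⊓, so it is constant or reads q ≤ a_i for one q ∈ J and one
argument i. Hence f is its diagonal u together with a choice of arguments on the support of u.
Passing to a minor keeps u and coarsens the induced partition (`le_iff`), which embeds the poset in
a disjoint union, over all u, of dual partition lattices.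

L is complemented iff J is an antichain. In that case the predicates can be chosen independently:
the embedding is onto, and counting the u by support size gives d_j with n = |J|.

Conversely, suppose the poset is the union for n. Unary classes are minimal and each copy has a
least element, so there are at most Σ d_j = (n+2)^n unary homomorphisms. A chain of n elements in
Π_n^∂ forces an antichain A ⊆ J with |A| ≥ n, since arguments in different blocks come from
incomparable elements. Such an A yields (|J|+2)^|A| unary homomorphisms, so |J| ≤ n ≤ |A| and A = J.
-/

/-! ### Sup-irreducible elements of a finite distributive lattice -/

/-- The subtype of sup-irreducible elements. -/
abbrev SupIrreds (L : Type*) [SemilatticeSup L] : Type _ := {p : L // SupIrred p}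

namespace SupIrreds

variable {L : Type*} [DistribLattice L]

theorem le_sup_iff (p : SupIrreds L) (x y : L) : (p : L) ≤ x ⊔ y ↔ (p : L) ≤ x ∨ (p : L) ≤ y :=
  p.2.supPrime.le_sup

variable [Finite L] [BoundedOrder L]

theorem le_of_forall_le {x y : L} (h : ∀ p : SupIrreds L, (p : L) ≤ x → (p : L) ≤ y) : x ≤ y := by
  obtain ⟨s, hs, hirr⟩ := exists_supIrred_decomposition x
  rw [← hs]
  refine Finset.sup_le fun p hp => h ⟨p, hirr hp⟩ ?_
  rw [← hs]
  exact Finset.le_sup (f := id) hp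

theorem eq_of_forall_le_iff {x y : L} (h : ∀ p : SupIrreds L, (p : L) ≤ x ↔ (p : L) ≤ y) :
    x = y :=
  le_antisymm (le_of_forall_le fun p => (h p).1) (le_of_forall_le fun p => (h p).2)

instance [Nontrivial L] : Nonempty (SupIrreds L) := by
  by_contra hne
  rw [not_nonempty_iff] at hne
  exact bot_ne_top (eq_of_forall_le_iff (L := L) fun p => hne.elim p)

/-- Birkhoff duality: f x is the join of all p with H p x, and primeness of p recovers H from it. -/
theorem exists_latticeHom {M : Type*} [Lattice M] (H : SupIrreds L → M → Prop)
    (hsup : ∀ p x y, H p (x ⊔ y) ↔ H p x ∨ H p y)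
    (hinf : ∀ p x y, H p (x ⊓ y) ↔ H p x ∧ H p y)
    (hanti : ∀ p q, p ≤ q → ∀ x, H q x → H p x) :
    ∃ f : LatticeHom M L, ∀ (p : SupIrreds L) (x : M), (p : L) ≤ f x ↔ H p x := by
  classical
  have := Fintype.ofFinite (SupIrreds L)
  let F : M → L := fun x => (Finset.univ.filter fun p : SupIrreds L => H p x).sup Subtype.val
  have hF : ∀ (p : SupIrreds L) (x : M), (p : L) ≤ F x ↔ H p x := by
    intro p x
    rw [p.2.supPrime.le_finset_sup]
    constructor
    · rintro ⟨q, hq, hpq⟩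
      exact hanti p q hpq x (by simpa using hq)
    · exact fun h => ⟨p, by simpa using h, le_rfl⟩
  exact ⟨{ toFun := F
           map_sup' := fun x y => eq_of_forall_le_iff fun p => by
             rw [le_sup_iff, hF, hF, hF, hsup]
           map_inf' := fun x y => eq_of_forall_le_iff fun p => by
             rw [_root_.le_inf_iff, hF, hF, hF, hinf] }, hF⟩

end SupIrreds

/-- A nonconstant H cuts out a proper nonempty prime filter, principal by finiteness; its generator
is the required q. -/
theorem forall_or_forall_not_or_exists_supIrred {M : Type*} [DistribLattice M] [Finite M]
    [BoundedOrder M] (H : M → Prop) (hsup : ∀ x y, H (x ⊔ y) ↔ H x ∨ H y)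
    (hinf : ∀ x y, H (x ⊓ y) ↔ H x ∧ H y) :
    (∀ x, H x) ∨ (∀ x, ¬ H x) ∨ ∃ q : SupIrreds M, ∀ x, H x ↔ (q : M) ≤ x := by
  have mono : ∀ x y, x ≤ y → H x → H y := fun x y hxy hx => by
    rw [← sup_eq_right.2 hxy, hsup]; exact Or.inl hx
  by_cases hb : H ⊥
  · exact Or.inl fun x => mono _ _ bot_le hb
  by_cases ht : H ⊤
  swap
  · exact Or.inr (Or.inl fun x hx => ht (mono _ _ le_top hx))
  obtain ⟨q, hq, hmin⟩ := (Set.toFinite {x | H x}).exists_minimal ⟨⊤, ht⟩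
  have hle : ∀ x, H x ↔ q ≤ x := fun x =>
    ⟨fun hx => (hmin ((hinf q x).2 ⟨hq, hx⟩) inf_le_left).trans inf_le_right,
      fun hx => mono _ _ hx hq⟩
  refine Or.inr (Or.inr ⟨⟨q, ?_, ?_⟩, hle⟩)
  · intro h
    exact hb (h.eq_bot ▸ hq)
  · intro a b hab
    have h := hq
    rw [Set.mem_ofPred_eq, ← hab, hsup, hle, hle] at h
    rcases h with h | h
    · exact Or.inl (le_antisymm (hab ▸ le_sup_left) h)
    · exact Or.inr (le_antisymm (hab ▸ le_sup_right) h)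

theorem SupIrred.exists_le_iff_apply_le {ι L : Type*} [DistribLattice L] [BoundedOrder L]
    {q : ι → L} (hq : SupIrred q) : ∃ i, ∀ a, q ≤ a ↔ q i ≤ a i := by
  classical
  have hne : ∃ i, q i ≠ ⊥ := by
    by_contra! h
    exact hq.ne_bot (funext h)
  obtain ⟨i, hi⟩ := hne
  -- Split q into its i-th coordinate and the rest; the rest alone cannot be q, since q i ≠ ⊥.
  have hdec : Function.update q i ⊥ ⊔ Function.update ⊥ i (q i) = q := by
    funext k
    by_cases hk : k = i
    · subst hk; simp
    · simp [hk]
  refine ⟨i, fun a => ⟨fun h => h i, fun h k => ?_⟩⟩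
  rcases hq.2 hdec with h' | h'
  · exact absurd (by simpa using (congrFun h' i).symm) hi
  · by_cases hk : k = i
    · exact hk ▸ h
    · refine (congrFun h' k).symm.le.trans ?_
      simp [hk]

/-! ### Decomposition of homomorphisms of several arguments -/

namespace MultiLatticeHom

section Diag
variable {L : Type*} [Lattice L]

/-- The unary homomorphism obtained by identifying all arguments. -/
def diag (f : MultiLatticeHom L L) : LatticeHom L L where
  toFun x := f.toHom fun _ => x
  map_sup' x y := map_sup f.toHom (fun _ => x) (fun _ => y)
  map_inf' x y := map_inf f.toHom (fun _ => x) (fun _ => y)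

theorem diag_apply (f : MultiLatticeHom L L) (x : L) : f.diag x = f.toHom fun _ => x := rfl

/-- A unary homomorphism as a homomorphism of several arguments. -/
def unary (u : LatticeHom L L) : MultiLatticeHom L L where
  arity := 1
  arity_pos := one_pos
  toHom :=
    { toFun := fun a => u (a 0)
      map_sup' := fun a b => map_sup u (a 0) (b 0)
      map_inf' := fun a b => map_inf u (a 0) (b 0) }

theorem unary_le_of_le {u : LatticeHom L L} {g : MultiLatticeHom L L} (h : g ≤ unary u) :
    unary u ≤ g := by
  obtain ⟨τ, hτ⟩ := h
  exact ⟨fun _ => (0 : Fin 1), fun a => (hτ fun _ => a (0 : Fin 1)).symm⟩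

theorem eq_of_unary_le {u v : LatticeHom L L} (h : unary u ≤ unary v) : u = v := by
  obtain ⟨τ, hτ⟩ := h
  exact LatticeHom.ext fun x => hτ fun _ => x

end Diag

variable {L : Type*} [DistribLattice L] [Finite L] [BoundedOrder L]

theorem exists_coord (f : MultiLatticeHom L L) (p : SupIrreds L) :
    ∃ i : Fin f.arity, ∀ a, (p : L) ≤ f.toHom a ↔ (p : L) ≤ f.diag (a i) := by
  rcases forall_or_forall_not_or_exists_supIrred (fun a => (p : L) ≤ f.toHom a)
    (fun x y => by rw [map_sup, p.le_sup_iff]) (fun x y => by rw [map_inf, le_inf_iff])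
    with h | h | ⟨q, h⟩
  · exact ⟨⟨0, f.arity_pos⟩, fun a => iff_of_true (h _) (h _)⟩
  · exact ⟨⟨0, f.arity_pos⟩, fun a => iff_of_false (h _) (h _)⟩
  · obtain ⟨i, hi⟩ := q.2.exists_le_iff_apply_le
    exact ⟨i, fun a => by rw [diag_apply, h, h, hi, hi]⟩

/-- The argument on which the `p`-component of `f` depends. -/
noncomputable def coord (f : MultiLatticeHom L L) (p : SupIrreds L) : Fin f.arity :=
  (f.exists_coord p).choose

theorem le_toHom_iff (f : MultiLatticeHom L L) (p : SupIrreds L) (a : Fin f.arity → L) :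
    (p : L) ≤ f.toHom a ↔ (p : L) ≤ f.diag (a (f.coord p)) :=
  (f.exists_coord p).choose_spec a

/-- The sup-irreducible elements at which the component of `u` is not constant. -/
abbrev Supp (u : LatticeHom L L) : Type _ :=
  {p : SupIrreds L // ¬ (p : L) ≤ u ⊥ ∧ (p : L) ≤ u ⊤}

omit [Finite L] in
theorem le_apply_iff_of_not_supp {u : LatticeHom L L} {p : SupIrreds L}
    (hp : ¬ (¬ (p : L) ≤ u ⊥ ∧ (p : L) ≤ u ⊤)) (x y : L) : (p : L) ≤ u x ↔ (p : L) ≤ u y := by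
  have hm : Monotone u := OrderHomClass.mono u
  by_cases hb : (p : L) ≤ u ⊥
  · exact iff_of_true (hb.trans (hm bot_le)) (hb.trans (hm bot_le))
  · have ht : ¬ (p : L) ≤ u ⊤ := fun ht => hp ⟨hb, ht⟩
    exact iff_of_false (fun h => ht (h.trans (hm le_top))) fun h => ht (h.trans (hm le_top))

theorem coord_eq_of_forall {f : MultiLatticeHom L L} {p : SupIrreds L}
    (hp : ¬ (p : L) ≤ f.diag ⊥ ∧ (p : L) ≤ f.diag ⊤) {i : Fin f.arity}
    (hi : ∀ a, (p : L) ≤ f.toHom a ↔ (p : L) ≤ f.diag (a i)) : f.coord p = i := by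
  classical
  by_contra hne
  have h := (f.le_toHom_iff p (Function.update ⊥ i ⊤)).symm.trans (hi _)
  rw [Function.update_of_ne hne, Function.update_self] at h
  exact hp.1 (h.2 hp.2)

/-- The partition of the support of `diag f` according to the arguments of `f`. -/
noncomputable def kernel (f : MultiLatticeHom L L) : Setoid (Supp f.diag) :=
  Setoid.ker fun p => f.coord p.1

theorem le_iff (g f : MultiLatticeHom L L) :
    g ≤ f ↔ g.diag = f.diag ∧ ∀ p q : Supp f.diag,
      f.coord p.1 = f.coord q.1 → g.coord p.1 = g.coord q.1 := by
  constructor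
  · rintro ⟨τ, hτ⟩
    have hd : g.diag = f.diag := LatticeHom.ext fun x => hτ fun _ => x
    have key : ∀ p : Supp f.diag, g.coord p.1 = τ (f.coord p.1) := fun p =>
      coord_eq_of_forall (by rw [hd]; exact p.2) fun a => by rw [hτ, le_toHom_iff, hd]
    exact ⟨hd, fun p q h => by rw [key, key, h]⟩
  · rintro ⟨hd, h⟩
    classical
    let τ : Fin f.arity → Fin g.arity := fun i =>
      -- Inessential arguments may go anywhere; positive arity supplies a target.
      if hi : ∃ p : Supp f.diag, f.coord p.1 = i then g.coord hi.choose.1 else ⟨0, g.arity_pos⟩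
    have hτ : ∀ p : Supp f.diag, τ (f.coord p.1) = g.coord p.1 := fun p => by
      have hi : ∃ q : Supp f.diag, f.coord q.1 = f.coord p.1 := ⟨p, rfl⟩
      simp only [τ, dif_pos hi]
      exact h _ _ hi.choose_spec
    refine ⟨τ, fun a => SupIrreds.eq_of_forall_le_iff fun p => ?_⟩
    rw [le_toHom_iff, le_toHom_iff, hd]
    by_cases hp : ¬ (p : L) ≤ f.diag ⊥ ∧ (p : L) ≤ f.diag ⊤
    · rw [hτ ⟨p, hp⟩]
    · exact le_apply_iff_of_not_supp hp _ _

omit [Finite L] in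
theorem sigma_le_iff {u v : LatticeHom L L} (r : Setoid (Supp u)) (s : Setoid (Supp v)) :
    (⟨u, OrderDual.toDual r⟩ : Σ u : LatticeHom L L, (Setoid (Supp u))ᵒᵈ) ≤
        ⟨v, OrderDual.toDual s⟩ ↔
      ∃ h : u = v, ∀ p q : Supp v, s p q → r ⟨p.1, h ▸ p.2⟩ ⟨q.1, h ▸ q.2⟩ := by
  rw [Sigma.le_def]
  constructor
  · rintro ⟨h, hle⟩
    dsimp only at h
    subst h
    exact ⟨rfl, fun p q hpq => (OrderDual.toDual_le_toDual.1 hle) hpq⟩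
  · rintro ⟨h, hle⟩
    subst h
    exact ⟨rfl, OrderDual.toDual_le_toDual.2 fun p q hpq => hle p q hpq⟩

/-- The diagonal of a homomorphism together with the partition of its support. -/
noncomputable def toSigma (f : MultiLatticeHom L L) : Σ u : LatticeHom L L, (Setoid (Supp u))ᵒᵈ :=
  ⟨f.diag, OrderDual.toDual f.kernel⟩

theorem toSigma_le_iff (g f : MultiLatticeHom L L) : g.toSigma ≤ f.toSigma ↔ g ≤ f := by
  rw [toSigma, toSigma, sigma_le_iff, le_iff]
  constructor
  · rintro ⟨hd, h⟩
    exact ⟨hd, h⟩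
  · rintro ⟨hd, h⟩
    exact ⟨hd, h⟩

/-- The minor homomorphism poset embeds into a disjoint union of dual partition lattices. -/
noncomputable def sigmaEmbedding :
    MinorHomPoset L ↪o Σ u : LatticeHom L L, (Setoid (Supp u))ᵒᵈ :=
  OrderEmbedding.ofMapLEIff (fun x => (ofAntisymmetrization (· ≤ ·) x).toSigma) fun x y => by
    rw [toSigma_le_iff, ofAntisymmetrization_le_ofAntisymmetrization_iff]

end MultiLatticeHom

/-! ### Antichains of sup-irreducibles, unary homomorphisms and complements -/

namespace SupIrreds

variable {L : Type*} [DistribLattice L]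

/-- The unary lattice predicate coded by a truth value or by a sup-irreducible element. -/
def Sat : Bool ⊕ SupIrreds L → L → Prop
  | .inl b, _ => b = true
  | .inr q, x => (q : L) ≤ x

theorem sat_sup (s : Bool ⊕ SupIrreds L) (x y : L) : Sat s (x ⊔ y) ↔ Sat s x ∨ Sat s y := by
  rcases s with b | q
  · simp [Sat]
  · exact q.le_sup_iff x y

theorem sat_inf (s : Bool ⊕ SupIrreds L) (x y : L) : Sat s (x ⊓ y) ↔ Sat s x ∧ Sat s y := by
  rcases s with b | q
  · simp [Sat]
  · exact le_inf_iff

variable [BoundedOrder L]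

theorem not_le_bot (q : SupIrreds L) : ¬ (q : L) ≤ ⊥ := fun h => q.2.ne_bot (le_bot_iff.1 h)

theorem sat_injective {s t : Bool ⊕ SupIrreds L} (h : ∀ x, Sat s x ↔ Sat t x) : s = t := by
  rcases s with b | p <;> rcases t with c | q
  · have := h ⊤
    simp only [Sat] at this
    rw [Bool.eq_iff_iff.2 this]
  · have h₁ := (h ⊤).2 le_top
    exact absurd ((h ⊥).1 h₁) q.not_le_bot
  · have h₁ := (h ⊤).1 le_top
    exact absurd ((h ⊥).2 h₁) p.not_le_bot
  · exact congrArg _ (Subtype.ext (le_antisymm ((h q).2 le_rfl) ((h p).1 le_rfl)))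

variable [Finite L]

theorem exists_latticeHom_of_isAntichain {A : Set (SupIrreds L)} (hA : IsAntichain (· ≤ ·) A)
    (ψ : SupIrreds L → Bool ⊕ SupIrreds L) :
    ∃ u : LatticeHom L L, ∀ p ∈ A, ∀ x, (p : L) ≤ u x ↔ Sat (ψ p) x := by
  classical
  obtain ⟨u, hu⟩ := exists_latticeHom (L := L) (M := L)
    -- Outside A the predicate is constant: true strictly below A, false elsewhere. This makes the
    -- family antitone in p for any ψ.
    (fun p x => if p ∈ A then Sat (ψ p) x else ∃ a ∈ A, p < a)
    (fun p x y => by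
      by_cases hp : p ∈ A
      · simp only [if_pos hp, sat_sup]
      · simp only [if_neg hp, or_self])
    (fun p x y => by
      by_cases hp : p ∈ A
      · simp only [if_pos hp, sat_inf]
      · simp only [if_neg hp, and_self])
    (fun p q hpq x hq => by
      rcases hpq.eq_or_lt with rfl | hlt
      · exact hq
      have hex : ∃ a ∈ A, p < a := by
        by_cases hqA : q ∈ A
        · exact ⟨q, hqA, hlt⟩
        · rw [if_neg hqA] at hq
          obtain ⟨a, ha, hqa⟩ := hq
          exact ⟨a, ha, hlt.trans hqa⟩
      have hp : p ∉ A := fun hp => by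
        obtain ⟨a, ha, hpa⟩ := hex
        exact hA hp ha hpa.ne hpa.le
      rwa [if_neg hp])
  exact ⟨u, fun p hp x => by rw [hu, if_pos hp]⟩

theorem card_pow_le_card_latticeHom {A : Finset (SupIrreds L)}
    (hA : IsAntichain (· ≤ ·) (A : Set (SupIrreds L))) :
    (Nat.card (SupIrreds L) + 2) ^ A.card ≤ Nat.card (LatticeHom L L) := by
  classical
  have : Finite (LatticeHom L L) := DFunLike.finite _
  choose F hF using fun ψ : A → Bool ⊕ SupIrreds L =>
    exists_latticeHom_of_isAntichain hA fun p => if hp : p ∈ A then ψ ⟨p, hp⟩ else .inl true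
  have hinj : Function.Injective F := fun ψ φ h => funext fun p => sat_injective fun x => by
    have h₁ := hF ψ p p.2 x
    have h₂ := hF φ p p.2 x
    rw [dif_pos p.2] at h₁ h₂
    rw [← h₁, h, h₂]
  have hcard := Nat.card_le_card_of_injective F hinj
  rwa [Nat.card_fun, Nat.card_sum, Nat.card_eq_fintype_card (α := Bool), Fintype.card_bool,
    Nat.card_eq_fintype_card (α := A), Fintype.card_coe, add_comm] at hcard

theorem complementedLattice_of_isAntichain
    (hA : IsAntichain (· ≤ ·) (Set.univ : Set (SupIrreds L))) : ComplementedLattice L := by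
  refine ⟨fun x => ?_⟩
  -- A homomorphism from the one-point lattice is just an element of L, here the join of all p not
  -- below x.
  obtain ⟨f, hf⟩ := exists_latticeHom (L := L) (M := Unit) (fun p _ => ¬ (p : L) ≤ x)
    (fun _ _ _ => (or_self_iff).symm) (fun _ _ _ => (and_self_iff).symm)
    (fun p q hpq _ h => by rwa [hA.eq (Set.mem_univ p) (Set.mem_univ q) hpq])
  refine ⟨f (), IsCompl.of_eq ?_ ?_⟩
  · refine eq_of_forall_le_iff fun p => ?_
    rw [le_inf_iff, hf]
    exact iff_of_false (fun h => h.2 h.1) p.not_le_bot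
  · refine eq_of_forall_le_iff fun p => ?_
    rw [le_sup_iff, hf]
    exact iff_of_true (em _) le_top

omit [Finite L] in
theorem isAntichain_of_complementedLattice [ComplementedLattice L] :
    IsAntichain (· ≤ ·) (Set.univ : Set (SupIrreds L)) := by
  rintro p - q - hne hle
  obtain ⟨c, hc⟩ := exists_isCompl (p : L)
  rcases (q.le_sup_iff (p : L) c).1 (by rw [hc.sup_eq_top]; exact le_top) with h | h
  · exact hne (Subtype.ext (le_antisymm hle h))
  · exact p.not_le_bot (hc.inf_eq_bot ▸ le_inf le_rfl (le_trans hle h))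

end SupIrreds

/-! ### Partitions and equivalence relations -/

/-- Finite partitions of a finite type are the same as equivalence relations. -/
noncomputable def Finpartition.orderIsoSetoid (α : Type*) [Fintype α] [DecidableEq α] :
    Finpartition (Finset.univ : Finset α) ≃o Setoid α where
  toFun P := Setoid.ker P.part
  invFun r := by classical exact Finpartition.ofSetoid r
  left_inv P := by
    classical
    refine le_antisymm ?_ ?_ <;> intro b hb
    · obtain ⟨x, hx⟩ := Finpartition.nonempty_of_mem_parts _ hb
      refine ⟨P.part x, P.part_mem.2 (Finset.mem_univ x), fun y hy => ?_⟩
      rw [← Finpartition.part_eq_of_mem _ hb hx, Finpartition.mem_part_ofSetoid_iff_rel] at hy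
      have h : P.part x = P.part y := hy
      rw [h]
      exact P.mem_part (Finset.mem_univ y)
    · obtain ⟨x, hx⟩ := P.nonempty_of_mem_parts hb
      refine ⟨_, Finpartition.part_mem _ |>.2 (Finset.mem_univ x), fun y hy => ?_⟩
      rw [Finpartition.mem_part_ofSetoid_iff_rel]
      exact (P.part_eq_of_mem hb hx).trans (P.part_eq_of_mem hb hy).symm
  right_inv r := by
    classical
    ext x y
    rw [Setoid.ker_def, ← Finpartition.mem_part_iff_part_eq_part _ (Finset.mem_univ _)
      (Finset.mem_univ _), Finpartition.mem_part_ofSetoid_iff_rel]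
    exact ⟨r.symm', r.symm'⟩
  map_rel_iff' {P Q} := by
    constructor
    · intro h b hb
      obtain ⟨x, hx⟩ := P.nonempty_of_mem_parts hb
      refine ⟨Q.part x, Q.part_mem.2 (Finset.mem_univ x), fun y hy => ?_⟩
      have hxy : Q.part x = Q.part y :=
        h (show P.part x = P.part y from
          (P.part_eq_of_mem hb hx).trans (P.part_eq_of_mem hb hy).symm)
      rw [hxy]
      exact Q.mem_part (Finset.mem_univ y)
    · intro h x y hxy
      obtain ⟨c, hc, hle⟩ := h (P.part_mem.2 (Finset.mem_univ x))
      have hy : y ∈ P.part x := by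
        rw [show P.part x = P.part y from hxy]; exact P.mem_part (Finset.mem_univ y)
      exact (Q.part_eq_of_mem hc (hle (P.mem_part (Finset.mem_univ x)))).trans
        (Q.part_eq_of_mem hc (hle hy)).symm

/-- Equivalent types have isomorphic lattices of equivalence relations. -/
def Setoid.orderIsoCongr {α β : Type*} (e : α ≃ β) : Setoid α ≃o Setoid β where
  toFun r := r.comap e.symm
  invFun r := r.comap e
  left_inv r := by ext x y; simp [Setoid.comap_rel]
  right_inv r := by ext x y; simp [Setoid.comap_rel]
  map_rel_iff' {r s} := by
    constructor
    · intro h x y hxy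
      have := @h (e x) (e y) (show r (e.symm (e x)) (e.symm (e y)) by simpa using hxy)
      change s (e.symm (e x)) (e.symm (e y)) at this
      simpa using this
    · intro h x y hxy
      exact h hxy

/-- Disjoint unions of orders along a bijection of the index types. -/
noncomputable def OrderIso.sigmaCongr {ι κ : Type*} {α : ι → Type*} {β : κ → Type*} [∀ i, LE (α i)]
    [∀ k, LE (β k)] (e : ι ≃ κ) (F : ∀ i, α i ≃o β (e i)) : (Σ i, α i) ≃o Σ k, β k where
  toEquiv := Equiv.sigmaCongr e fun i => (F i).toEquiv
  map_rel_iff' {a b} := by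
    obtain ⟨i, a⟩ := a
    obtain ⟨j, b⟩ := b
    constructor
    · intro h
      by_cases hij : i = j
      · subst hij
        exact Sigma.mk_le_mk_iff.2 ((F i).le_iff_le.1 (Sigma.mk_le_mk_iff.1 h))
      · obtain ⟨h, -⟩ := Sigma.le_def.1 h
        exact absurd (e.injective h) hij
    · rintro ⟨i, a, b, h⟩
      exact Sigma.mk_le_mk_iff.2 ((F i).le_iff_le.2 h)

theorem Setoid.card_quotient_lt_of_lt {α : Type*} [Finite α] {r s : Setoid α} (h : r < s) :
    Nat.card (Quotient s) < Nat.card (Quotient r) := by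
  let F : Quotient r → Quotient s := Quotient.map id fun _ _ hab => h.le hab
  have hF : Function.Surjective F := by
    rintro ⟨x⟩
    exact ⟨Quotient.mk r x, rfl⟩
  refine lt_of_le_of_ne (Nat.card_le_card_of_surjective F hF) fun heq => h.not_ge ?_
  have hinj : Function.Injective F :=
    ((Nat.bijective_iff_surjective_and_card F).2 ⟨hF, heq.symm⟩).1
  intro x y hxy
  exact Quotient.exact (hinj (show F (Quotient.mk r x) = F (Quotient.mk r y) from
    Quotient.sound hxy))

/-! ### Size, least elements and chains of the disjoint union -/

namespace DualPartitionUnion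

theorem card_index (n : ℕ) :
    Nat.card (Σ j : Fin (n + 1), Fin (n.choose j * n ^ (j : ℕ) * 2 ^ (n - (j : ℕ)))) =
      (n + 2) ^ n := by
  rw [Nat.card_eq_fintype_card, Fintype.card_sigma, add_pow]
  simp only [Fintype.card_fin]
  rw [Fin.sum_univ_eq_sum_range fun j => n.choose j * n ^ j * 2 ^ (n - j)]
  exact Finset.sum_congr rfl fun j _ => by rw [Nat.cast_id]; ring

theorem exists_le_and_le {n : ℕ} {x y : DualPartitionUnion n} (h : x.1 = y.1) :
    ∃ z, z ≤ x ∧ z ≤ y := by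
  obtain ⟨i, x⟩ := x
  obtain ⟨k, y⟩ := y
  dsimp only at h
  subst h
  let e := Finpartition.orderIsoSetoid (Fin (i.1 : ℕ))
  have key : ∀ w : (PartitionLattice (i.1 : ℕ))ᵒᵈ,
      OrderDual.toDual (e.symm ⊤) ≤ w := fun w =>
    OrderDual.toDual_le.2 (e.le_symm_apply.2 le_top)
  exact ⟨⟨i, OrderDual.toDual (e.symm ⊤)⟩, Sigma.mk_le_mk_iff.2 (key x),
    Sigma.mk_le_mk_iff.2 (key y)⟩

theorem exists_strictMono {n : ℕ} (hn : 1 ≤ n) : ∃ c : Fin n → DualPartitionUnion n, StrictMono c := by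
  have hpos : 0 < n.choose (Fin.last n) * n ^ (Fin.last n : ℕ) * 2 ^ (n - (Fin.last n : ℕ)) := by
    simp only [Fin.val_last, Nat.choose_self, one_mul, Nat.sub_self, pow_zero, mul_one]
    exact pow_pos hn n
  let e : PartitionLattice ((Fin.last n : Fin (n + 1)) : ℕ) ≃o Setoid (Fin n) :=
    Finpartition.orderIsoSetoid (Fin n)
  -- Everything from k upwards is merged, leaving k + 1 blocks.
  let r : Fin n → Setoid (Fin n) := fun k => Setoid.ker fun x => min x k
  have hr : StrictAnti r := by
    intro k l hkl
    refine lt_of_le_not_ge (fun x y h => ?_) fun h => ?_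
    · change min x k = min y k
      have h : min x l = min y l := h
      rw [← min_eq_right hkl.le, ← min_assoc, h, min_assoc]
    · have : min k l = min l l := @h k l (show min k k = min l k by simp [hkl.le])
      rw [min_self, min_eq_left hkl.le] at this
      exact hkl.ne this
  refine ⟨fun k => ⟨⟨Fin.last n, ⟨0, hpos⟩⟩, OrderDual.toDual (e.symm (r k))⟩, fun k l hkl => ?_⟩
  rw [Sigma.mk_lt_mk_iff]
  exact OrderDual.toDual_lt_toDual.2 (e.symm.strictMono (hr hkl))

end DualPartitionUnion

/-! ### From an isomorphism to complementedness -/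

namespace MultiLatticeHom

section Converse

variable {L : Type*} [DistribLattice L] [Finite L]

omit [Finite L] in
theorem card_latticeHom_le {n : ℕ} (φ : MinorHomPoset L ≃o DualPartitionUnion n) :
    Nat.card (LatticeHom L L) ≤ (n + 2) ^ n := by
  rw [← DualPartitionUnion.card_index]
  have hinj : Function.Injective fun u : LatticeHom L L =>
      (φ (toAntisymmetrization (· ≤ ·) (unary u))).1 := fun u v h => by
    obtain ⟨z, hu, hv⟩ := DualPartitionUnion.exists_le_and_le h
    rw [← φ.symm_apply_le] at hu hv
    obtain ⟨g, hg⟩ : ∃ g, toAntisymmetrization (· ≤ ·) g = φ.symm z :=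
      ⟨_, toAntisymmetrization_ofAntisymmetrization _ _⟩
    rw [← hg, toAntisymmetrization_le_toAntisymmetrization_iff] at hu hv
    exact eq_of_unary_le ((unary_le_of_le hu).trans hv)
  exact Nat.card_le_card_of_injective _ hinj

variable [BoundedOrder L]

theorem not_le_of_coord_ne (f : MultiLatticeHom L L) {p q : Supp f.diag}
    (h : f.coord p.1 ≠ f.coord q.1) : ¬ p.1 ≤ q.1 := by
  classical
  intro hpq
  -- This tuple satisfies the q-component and fails the p-component.
  let a : Fin f.arity → L := Function.update ⊥ (f.coord q.1) ⊤
  have hq : (q.1 : L) ≤ f.toHom a := by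
    simp only [le_toHom_iff, a, Function.update_self]
    exact q.2.2
  have hp : (p.1 : L) ≤ f.toHom a := le_trans hpq hq
  simp only [le_toHom_iff, a, Function.update_of_ne h] at hp
  exact p.2.1 hp

theorem exists_isAntichain_card_eq (f : MultiLatticeHom L L) :
    ∃ A : Finset (SupIrreds L), IsAntichain (· ≤ ·) (A : Set (SupIrreds L)) ∧
      A.card = Nat.card (Quotient f.kernel) := by
  classical
  have := Fintype.ofFinite (Quotient f.kernel)
  have key : ∀ c d : Quotient f.kernel, c ≠ d → ¬ c.out.1 ≤ d.out.1 := fun c d hcd => by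
    refine f.not_le_of_coord_ne fun h => hcd ?_
    rw [← Quotient.out_eq c, ← Quotient.out_eq d]
    exact Quotient.sound h
  refine ⟨Finset.univ.image fun c : Quotient f.kernel => c.out.1, ?_, ?_⟩
  · intro p hp q hq hpq
    simp only [Finset.coe_image, Finset.coe_univ, Set.image_univ, Set.mem_range] at hp hq
    obtain ⟨c, rfl⟩ := hp
    obtain ⟨d, rfl⟩ := hq
    exact key c d fun h => hpq (h ▸ rfl)
  · rw [Finset.card_image_of_injective, Finset.card_univ, Nat.card_eq_fintype_card]
    intro c d hcd
    by_contra hne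
    exact key c d hne hcd.le

/-- The number of essential arguments, but at least `1`. -/
noncomputable def rank (x : Σ u : LatticeHom L L, (Setoid (Supp u))ᵒᵈ) : ℕ :=
  max 1 (Nat.card (Quotient (OrderDual.ofDual x.2)))

/-- Strict comparison needs a nonempty support, where there is at least one block and the `max` has
no effect. -/
theorem rank_strictMono : StrictMono (rank (L := L)) := by
  rintro ⟨u, r⟩ ⟨v, s⟩ h
  obtain ⟨u, r, s, h⟩ := h
  have hlt : OrderDual.ofDual s < OrderDual.ofDual r := h
  have hne : Nonempty (Supp u) := by
    by_contra hempty
    rw [not_nonempty_iff] at hempty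
    exact hlt.not_ge fun x => hempty.elim x
  have hpos : 0 < Nat.card (Quotient (OrderDual.ofDual r)) :=
    have : Nonempty (Quotient (OrderDual.ofDual r)) := hne.map (Quotient.mk _)
    Nat.card_pos
  have hcard := Setoid.card_quotient_lt_of_lt hlt
  simp only [rank]
  omega

theorem exists_isAntichain_of_strictMono [Nontrivial L] {n : ℕ} {c : Fin n → MinorHomPoset L}
    (hc : StrictMono c) :
    ∃ A : Finset (SupIrreds L), IsAntichain (· ≤ ·) (A : Set (SupIrreds L)) ∧ n ≤ A.card := by
  by_contra! hlt
  have hrank : ∀ k, rank (sigmaEmbedding (c k)) < n := fun k => by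
    refine max_lt ?_ ?_
    · obtain ⟨p⟩ := (inferInstance : Nonempty (SupIrreds L))
      simpa using hlt {p} (by simp)
    · obtain ⟨A, hA, hcard⟩ := exists_isAntichain_card_eq (ofAntisymmetrization (· ≤ ·) (c k))
      exact hcard ▸ hlt A hA
  have hmono : StrictMono fun k => rank (sigmaEmbedding (c k)) :=
    rank_strictMono.comp (sigmaEmbedding.strictMono.comp hc)
  -- The n distinct ranks would lie among the n - 1 values 1, …, n - 1; this is why rank starts at
  -- 1.
  have hsub := Finset.card_le_card_of_injOn (s := Finset.univ) (t := Finset.Ico 1 n)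
    (fun k => rank (sigmaEmbedding (c k)))
    (fun k _ => Finset.mem_coe.2 (Finset.mem_Ico.2 ⟨le_max_left _ _, hrank k⟩))
    hmono.injective.injOn
  rw [Finset.card_univ, Fintype.card_fin, Nat.card_Ico] at hsub
  have hn : n = 0 := by omega
  have := hlt ∅ (by simp)
  omega

theorem complementedLattice_of_orderIso [Nontrivial L] {n : ℕ} (hn : 1 ≤ n)
    (φ : MinorHomPoset L ≃o DualPartitionUnion n) : ComplementedLattice L := by
  classical
  have := Fintype.ofFinite (SupIrreds L)
  obtain ⟨c, hc⟩ := DualPartitionUnion.exists_strictMono hn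
  obtain ⟨A, hA, hnA⟩ := exists_isAntichain_of_strictMono (φ.symm.strictMono.comp hc)
  have hpow : (Nat.card (SupIrreds L) + 2) ^ n ≤ (n + 2) ^ n :=
    ((Nat.pow_le_pow_right (by omega) hnA).trans
      (SupIrreds.card_pow_le_card_latticeHom hA)).trans (card_latticeHom_le φ)
  have hle : Nat.card (SupIrreds L) + 2 ≤ n + 2 := (Nat.pow_le_pow_iff_left (by omega)).1 hpow
  have huniv : A = Finset.univ := by
    refine Finset.eq_univ_of_card A (le_antisymm A.card_le_univ ?_)
    rw [← Nat.card_eq_fintype_card]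
    omega
  refine SupIrreds.complementedLattice_of_isAntichain ?_
  rwa [huniv, Finset.coe_univ] at hA

end Converse

/-! ### Complemented lattices -/

section Complemented

variable {L : Type*} [DistribLattice L] [Finite L] [BoundedOrder L]

theorem sigmaEmbedding_surjective [Nontrivial L]
    (hA : IsAntichain (· ≤ ·) (Set.univ : Set (SupIrreds L))) :
    Function.Surjective (sigmaEmbedding (L := L)) := by
  classical
  rintro ⟨u, r⟩
  obtain ⟨r, rfl⟩ := OrderDual.toDual.surjective r
  let e := Finite.equivFin (SupIrreds L)
  let c : SupIrreds L → Fin (Nat.card (SupIrreds L)) := fun p =>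
    -- Each block of r gets one argument, indexed by its representative; off the support the choice
    -- is immaterial.
    if hp : ¬ (p : L) ≤ u ⊥ ∧ (p : L) ≤ u ⊤ then e (Quotient.mk r ⟨p, hp⟩).out.1 else e p
  obtain ⟨F, hF⟩ := SupIrreds.exists_latticeHom (L := L)
    (M := Fin (Nat.card (SupIrreds L)) → L) (fun p a => (p : L) ≤ u (a (c p)))
    (fun p a b => by rw [Pi.sup_apply, map_sup, p.le_sup_iff])
    (fun p a b => by rw [Pi.inf_apply, map_inf, le_inf_iff])
    (fun p q hpq a h => by rwa [hA.eq (Set.mem_univ p) (Set.mem_univ q) hpq])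
  let f : MultiLatticeHom L L := ⟨_, Nat.card_pos, F⟩
  have hd : f.diag = u :=
    LatticeHom.ext fun x => SupIrreds.eq_of_forall_le_iff fun p => hF p fun _ => x
  have hcoord : ∀ p : Supp u, f.coord p.1 = c p.1 := fun p =>
    coord_eq_of_forall (by rw [hd]; exact p.2) fun a => by rw [hd]; exact hF p.1 a
  have hker : ∀ p q : Supp u, f.coord p.1 = f.coord q.1 ↔ r p q := fun p q => by
    rw [hcoord, hcoord]
    simp only [c]
    rw [dif_pos p.2, dif_pos q.2, e.injective.eq_iff, Subtype.val_injective.eq_iff,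
      Quotient.out_inj, Quotient.eq]
  have hle : f.toSigma ≤ ⟨u, OrderDual.toDual r⟩ ∧ ⟨u, OrderDual.toDual r⟩ ≤ f.toSigma := by
    rw [toSigma, sigma_le_iff, sigma_le_iff]
    exact ⟨⟨hd, fun p q => (hker p q).2⟩,
      ⟨hd.symm, fun p q => (hker ⟨p.1, hd ▸ p.2⟩ ⟨q.1, hd ▸ q.2⟩).1⟩⟩
  refine ⟨toAntisymmetrization (· ≤ ·) f, ?_⟩
  rw [← le_antisymm hle.1 hle.2]
  have h : AntisymmRel (· ≤ ·)
      (ofAntisymmetrization (· ≤ ·) (toAntisymmetrization (· ≤ ·) f)) f :=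
    Quotient.exact (toAntisymmetrization_ofAntisymmetrization (· ≤ ·) _)
  exact le_antisymm ((toSigma_le_iff _ _).2 h.1) ((toSigma_le_iff _ _).2 h.2)

/-- Choose the j positions with values in J, then fill them in |J|^j ways and the others in 2^(|J| -
j) ways. -/
theorem card_filter_isRight (J : Type*) [Fintype J] [DecidableEq J] (j : ℕ) :
    Fintype.card {ψ : J → Bool ⊕ J // Fintype.card {p // (ψ p).isRight} = j} =
      (Fintype.card J).choose j * Fintype.card J ^ j * 2 ^ (Fintype.card J - j) := by
  classical
  let T : (J → Bool ⊕ J) → Finset J := fun ψ => Finset.univ.filter fun p => (ψ p).isRight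
  have hfib : ∀ S ∈ Finset.powersetCard j (Finset.univ : Finset J),
      (Finset.univ.filter fun ψ => T ψ = S).card =
        Fintype.card J ^ j * 2 ^ (Fintype.card J - j) := by
    intro S hS
    have hS := (Finset.mem_powersetCard.1 hS).2
    have heq : (Finset.univ.filter fun ψ => T ψ = S) = Fintype.piFinset fun p =>
        if p ∈ S then Finset.univ.map (Function.Embedding.inr (α := Bool) (β := J))
        else Finset.univ.map Function.Embedding.inl := by
      ext ψ
      simp only [Finset.mem_filter, Finset.mem_univ, true_and, Fintype.mem_piFinset, T,
        Finset.ext_iff]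
      refine forall_congr' fun p => ?_
      by_cases hp : p ∈ S <;> rcases ψ p with b | q <;> simp [hp]
    rw [heq, Fintype.card_piFinset]
    simp only [apply_ite Finset.card, Finset.card_map, Finset.card_univ, Fintype.card_bool]
    rw [Finset.prod_ite, Finset.prod_const, Finset.prod_const, Finset.filter_mem_eq_inter,
      Finset.univ_inter, hS, Finset.filter_notMem_eq_sdiff, ← Finset.compl_eq_univ_sdiff,
      Finset.card_compl, hS]
  rw [Fintype.card_subtype]
  have hT : ∀ ψ, Fintype.card {p // (ψ p).isRight} = (T ψ).card := fun ψ =>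
    Fintype.card_subtype _
  simp only [hT]
  rw [Finset.card_eq_sum_card_fiberwise (f := T)
    (t := Finset.powersetCard j (Finset.univ : Finset J))
    (fun ψ hψ => by simpa using hψ)]
  have hsum : ∀ S ∈ Finset.powersetCard j (Finset.univ : Finset J),
      ((Finset.univ.filter fun ψ => (T ψ).card = j).filter fun ψ => T ψ = S).card =
        Fintype.card J ^ j * 2 ^ (Fintype.card J - j) := fun S hS => by
    rw [← hfib S hS, Finset.filter_filter]
    congr 1
    refine Finset.filter_congr fun ψ _ => and_iff_right_of_imp fun h => ?_
    rw [h]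
    exact (Finset.mem_powersetCard.1 hS).2
  rw [Finset.sum_congr rfl hsum, Finset.sum_const, Finset.card_powersetCard, Finset.card_univ,
    smul_eq_mul, mul_assoc]

/-- On an antichain, unary homomorphisms correspond to arbitrary codings ψ : J → Bool ⊕ J, and the
support is where ψ takes values in J. -/
theorem card_latticeHom_supp (hA : IsAntichain (· ≤ ·) (Set.univ : Set (SupIrreds L))) (j : ℕ) :
    Nat.card {u : LatticeHom L L // Nat.card (Supp u) = j} =
      (Nat.card (SupIrreds L)).choose j * Nat.card (SupIrreds L) ^ j *
        2 ^ (Nat.card (SupIrreds L) - j) := by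
  classical
  have := Fintype.ofFinite (SupIrreds L)
  choose F hF using SupIrreds.exists_latticeHom_of_isAntichain hA
  have hF : ∀ ψ (p : SupIrreds L) x, (p : L) ≤ F ψ x ↔ SupIrreds.Sat (ψ p) x := fun ψ p =>
    hF ψ p (Set.mem_univ p)
  have hinj : Function.Injective F := fun ψ φ h => funext fun p =>
    SupIrreds.sat_injective fun x => by rw [← hF, ← hF, h]
  have hsurj : Function.Surjective F := fun u => by
    have hex : ∀ p : SupIrreds L, ∃ s : Bool ⊕ SupIrreds L,
        ∀ x, (p : L) ≤ u x ↔ SupIrreds.Sat s x := fun p => by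
      rcases forall_or_forall_not_or_exists_supIrred (fun x => (p : L) ≤ u x)
        (fun x y => by rw [map_sup, p.le_sup_iff]) (fun x y => by rw [map_inf, le_inf_iff])
        with h | h | ⟨q, h⟩
      · exact ⟨.inl true, fun x => iff_of_true (h x) rfl⟩
      · exact ⟨.inl false, fun x => iff_of_false (h x) Bool.false_ne_true⟩
      · exact ⟨.inr q, h⟩
    choose ψ hψ using hex
    exact ⟨ψ, LatticeHom.ext fun x => SupIrreds.eq_of_forall_le_iff fun p => by rw [hF, hψ]⟩
  have hsupp : ∀ ψ (p : SupIrreds L), (ψ p).isRight ↔ ¬ (p : L) ≤ F ψ ⊥ ∧ (p : L) ≤ F ψ ⊤ := fun ψ p => by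
    rw [hF, hF]
    rcases ψ p with b | q
    · simp [SupIrreds.Sat]
    · simp [SupIrreds.Sat, q.2.ne_bot]
  rw [Nat.card_eq_fintype_card (α := SupIrreds L), ← card_filter_isRight,
    ← Nat.card_eq_fintype_card]
  refine (Nat.card_congr ((Equiv.ofBijective F ⟨hinj, hsurj⟩).subtypeEquiv fun ψ => ?_)).symm
  rw [← Nat.card_eq_fintype_card, Nat.card_congr (Equiv.subtypeEquivRight (hsupp ψ))]
  rfl

theorem nonempty_orderIso_of_isAntichain [Nontrivial L]
    (hA : IsAntichain (· ≤ ·) (Set.univ : Set (SupIrreds L))) :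
    Nonempty (MinorHomPoset L ≃o DualPartitionUnion (Nat.card (SupIrreds L))) := by
  classical
  have : Finite (LatticeHom L L) := DFunLike.finite _
  let n := Nat.card (SupIrreds L)
  let s : LatticeHom L L → Fin (n + 1) := fun u =>
    ⟨Nat.card (Supp u), Nat.lt_succ_of_le (Finite.card_subtype_le _)⟩
  have hcard : ∀ j : Fin (n + 1), Nat.card {u // s u = j} =
      n.choose j * n ^ (j : ℕ) * 2 ^ (n - (j : ℕ)) := fun j => by
    rw [← card_latticeHom_supp hA]
    exact Nat.card_congr (Equiv.subtypeEquivRight fun u => Fin.ext_iff)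
  let E : LatticeHom L L ≃ Σ j : Fin (n + 1), Fin (n.choose j * n ^ (j : ℕ) * 2 ^ (n - (j : ℕ))) :=
    (Equiv.sigmaFiberEquiv s).symm.trans
      (Equiv.sigmaCongrRight fun j => Finite.equivFinOfCardEq (hcard j))
  have hE : ∀ u, Nat.card (Supp u) = ((E u).1 : ℕ) := fun u => rfl
  let G : ∀ u, (Setoid (Supp u))ᵒᵈ ≃o (PartitionLattice ((E u).1 : ℕ))ᵒᵈ := fun u =>
    ((Setoid.orderIsoCongr (Finite.equivFinOfCardEq (hE u))).trans
      (Finpartition.orderIsoSetoid _).symm).dual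
  exact ⟨(RelIso.ofSurjective sigmaEmbedding (sigmaEmbedding_surjective hA)).trans
    (OrderIso.sigmaCongr E G)⟩

end Complemented

end MultiLatticeHom

theorem mainTheorem8 (L : Type*) [DistribLattice L] [Finite L] [Nontrivial L] :
    (∃ _ : BoundedOrder L, ComplementedLattice L) ↔
      ∃ n : ℕ, 1 ≤ n ∧ Nonempty (MinorHomPoset L ≃o DualPartitionUnion n) := by
  constructor
  · rintro ⟨_, _⟩
    exact ⟨Nat.card (SupIrreds L), Nat.card_pos,
      MultiLatticeHom.nonempty_orderIso_of_isAntichain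
        SupIrreds.isAntichain_of_complementedLattice⟩
  · rintro ⟨n, hn, ⟨φ⟩⟩
    have := Fintype.ofFinite L
    let _ : BoundedOrder L := Fintype.toBoundedOrder L
    exact ⟨inferInstance, MultiLatticeHom.complementedLattice_of_orderIso hn φ⟩
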